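/- Let $k$ be an algebraically closed field. By a variety over $k$ we mean an integral separated scheme of finite type over $k$. The arc space $X_\infty$ of a $k$-scheme $X$ is the $k$-scheme that represents the functor $T \mapsto \varprojlim_m \operatorname{Hom}_k\big(T \times_k \operatorname{Spec} k[t]/(t^{m+1}),\, X\big)$ on $k$-schemes $T$, and for a morphism $f \colon X \to Y$ of $k$-schemes we denote by $f_\infty \colon X_\infty \to Y_\infty$ the morphism induced by composition with $f$. A scheme $Z$ is called topologically finite if its underlying topological space is finite and discrete; in this case $|Z|$ denotes its number of points. Let $f \colon X \to Y$ be a finite surjective morphism between varieties over $k$, and assume that $Y$ is normal. Let $\operatorname{sepdeg} f := [k(X) : k(Y)]_{\mathrm{sep}}$ be the separable degree of the induced finite extension of function fields, i.e. the degree over $k(Y)$ of the separable closure of $k(Y)$ in $k(X)$. Then, for every (not necessarily closed) point $\beta \in Y_\infty$, the scheme-theoretic fiber $f_\infty^{-1}(\beta)$ is topologically finite and $$|f_\infty^{-1}(\beta)| \leq \operatorname{sepdeg} f .$$ -/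

import Mathlib

universe u

noncomputable section

open CategoryTheory Limits Opposite AlgebraicGeometry Polynomial

namespace ArcSpaces

/-! ### Truncated polynomial rings -/

/-- The truncated polynomial ring `R[t]/(t^{m+1})`. -/
abbrev TruncPoly (R : Type u) [CommRing R] (m : ℕ) : Type u :=
  R[X] ⧸ Ideal.span {(X : R[X]) ^ (m + 1)}

namespace TruncPoly

variable {R : Type u} [CommRing R] {S : Type u} [CommRing S]

lemma span_le {m n : ℕ} (h : m ≤ n) :
    Ideal.span {(X : R[X]) ^ (n + 1)} ≤ Ideal.span {(X : R[X]) ^ (m + 1)} := by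
  rw [Ideal.span_singleton_le_span_singleton]
  exact pow_dvd_pow _ (by omega)

/-- The truncation `R[t]/(t^{m+2}) → R[t]/(t^{m+1})`. -/
def res (R : Type u) [CommRing R] (m : ℕ) : TruncPoly R (m + 1) →+* TruncPoly R m :=
  Ideal.Quotient.factor (span_le (Nat.le_succ m))

lemma mk_eq_mk {m : ℕ} {p q : R[X]} :
    (Ideal.Quotient.mk _ p : TruncPoly R m) = Ideal.Quotient.mk _ q ↔
      ∀ n < m + 1, p.coeff n = q.coeff n := by
  rw [Ideal.Quotient.eq, Ideal.mem_span_singleton, Polynomial.X_pow_dvd_iff]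
  simp [sub_eq_zero]

/-- The value at `t = 0`. -/
def evalZero (R : Type u) [CommRing R] (m : ℕ) : TruncPoly R m →+* R :=
  Ideal.Quotient.lift _ (Polynomial.eval₂RingHom (RingHom.id R) 0) (by
    intro a ha
    obtain ⟨b, rfl⟩ := Ideal.mem_span_singleton.1 ha
    simp)

/-- The inclusion of constants. -/
def const (R : Type u) [CommRing R] (m : ℕ) : R →+* TruncPoly R m :=
  (Ideal.Quotient.mk _).comp Polynomial.C

/-- Base change of the coefficients. -/
def map (φ : R →+* S) (m : ℕ) : TruncPoly R m →+* TruncPoly S m :=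
  Ideal.quotientMap _ (Polynomial.mapRingHom φ) (by
    rw [Ideal.span_le]
    simp [Ideal.mem_comap, Ideal.mem_span_singleton_self])

lemma hom_ext {m : ℕ} {f g : TruncPoly R m →+* S}
    (h : f.comp (const R m) = g.comp (const R m))
    (hX : f (Ideal.Quotient.mk _ X) = g (Ideal.Quotient.mk _ X)) : f = g := by
  refine Ideal.Quotient.ringHom_ext (Polynomial.ringHom_ext (fun a ↦ ?_) hX)
  exact RingHom.congr_fun h a

lemma evalZero_surjective (m : ℕ) : Function.Surjective (evalZero R m) := fun r ↦
  ⟨const R m r, by simp [evalZero, const]⟩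

lemma isNilpotent_of_evalZero {m : ℕ} {x : TruncPoly R m} (h : evalZero R m x = 0) :
    IsNilpotent x := by
  obtain ⟨p, rfl⟩ := Ideal.Quotient.mk_surjective x
  refine ⟨m + 1, ?_⟩
  rw [← map_pow, Ideal.Quotient.eq_zero_iff_mem, Ideal.mem_span_singleton]
  apply pow_dvd_pow_of_dvd
  rw [Polynomial.X_dvd_iff]
  simpa [evalZero, Polynomial.eval₂_at_zero] using h

lemma map_const (φ : R →+* S) (m : ℕ) : (map φ m).comp (const R m) = (const S m).comp φ := by
  ext r
  simp [map, const]

lemma map_res (φ : R →+* S) (m : ℕ) :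
    (map φ m).comp (res R m) = (res S m).comp (map φ (m + 1)) := by
  refine hom_ext ?_ ?_
  · ext r
    simp [map, const, res]
  · simp [map, res]

lemma res_const (m : ℕ) : (res R m).comp (const R (m + 1)) = const R m := by
  ext r
  simp [const, res]

lemma evalZero_res (m : ℕ) : (evalZero R m).comp (res R m) = evalZero R (m + 1) := by
  refine hom_ext ?_ ?_
  · ext r
    simp [evalZero, const, res]
  · simp [evalZero, res]

lemma isPushout {R S : CommRingCat.{u}} (φ : R ⟶ S) (m : ℕ) :
    IsPushout φ (CommRingCat.ofHom (const R m)) (CommRingCat.ofHom (const S m))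
      (CommRingCat.ofHom (map φ.hom m)) := by
  refine ⟨⟨?_⟩, ⟨PushoutCocone.IsColimit.mk _ (fun s ↦ CommRingCat.ofHom
    (Ideal.Quotient.lift _ (Polynomial.eval₂RingHom s.inl.hom
      (s.inr.hom (Ideal.Quotient.mk _ X))) ?_)) ?_ ?_ ?_⟩⟩
  · ext : 1
    exact (map_const φ.hom m).symm
  · intro a ha
    obtain ⟨b, rfl⟩ := Ideal.mem_span_singleton.1 ha
    rw [map_mul, map_pow]
    simp only [coe_eval₂RingHom, eval₂_X, ← map_pow]
    rw [Ideal.Quotient.eq_zero_iff_mem.2 (Ideal.mem_span_singleton_self _)]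
    simp
  · intro s
    ext r
    simp [const]
  · intro s
    ext : 1
    refine hom_ext ?_ ?_
    · ext r
      have := ConcreteCategory.congr_hom s.condition r
      simpa [const, map] using this
    · simp [map]
  · intro s f h₁ h₂
    ext : 1
    refine hom_ext ?_ ?_
    · ext r
      have := ConcreteCategory.congr_hom h₁ r
      simpa [const] using this
    · have := ConcreteCategory.congr_hom h₂ (Ideal.Quotient.mk _ X)
      simpa [map] using this

/-- Truncation of power series. -/
def ofPowerSeries (R : Type u) [CommRing R] (m : ℕ) :
    PowerSeries R →+* TruncPoly R m where
  toFun f := Ideal.Quotient.mk _ (PowerSeries.trunc (m + 1) f)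
  map_one' := by simp [PowerSeries.trunc_one]
  map_zero' := by simp
  map_add' := by simp
  map_mul' f g := by
    rw [← map_mul, mk_eq_mk]
    intro n hn
    rw [PowerSeries.coeff_trunc, if_pos hn, ← Polynomial.coeff_coe, Polynomial.coe_mul,
      PowerSeries.coeff_mul_eq_coeff_trunc_mul_trunc _ _ hn]

lemma ofPowerSeries_jointly_injective {f g : PowerSeries R}
    (h : ∀ m, ofPowerSeries R m f = ofPowerSeries R m g) : f = g := by
  ext n
  have := mk_eq_mk.1 (h n) n (by omega)
  simpa [PowerSeries.coeff_trunc] using this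

lemma exists_powerSeries (x : ∀ m, TruncPoly R m) (hx : ∀ m, res R m (x (m + 1)) = x m) :
    ∃ f : PowerSeries R, ∀ m, ofPowerSeries R m f = x m := by
  choose p hp using fun m ↦ Ideal.Quotient.mk_surjective (x m)
  have key : ∀ m n, m ≤ n → ∀ i < m + 1, (p m).coeff i = (p n).coeff i := by
    intro m n hmn
    induction n, hmn using Nat.le_induction with
    | base => intros; rfl
    | succ n hmn ih =>
      intro i hi
      rw [ih i hi]
      have := hx n
      rw [← hp, ← hp, res, Ideal.Quotient.factor_mk, mk_eq_mk] at this
      exact (this i (by omega)).symm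
  refine ⟨PowerSeries.mk fun n ↦ (p n).coeff n, fun m ↦ ?_⟩
  rw [← hp]
  refine mk_eq_mk.2 fun n hn ↦ ?_
  rw [PowerSeries.coeff_trunc, if_pos hn, PowerSeries.coeff_mk]
  exact key n m (by omega) n (by omega)

lemma res_ofPowerSeries (m : ℕ) :
    (res R m).comp (ofPowerSeries R (m + 1)) = ofPowerSeries R m := by
  ext f
  refine mk_eq_mk.2 fun n hn ↦ ?_
  simp [PowerSeries.coeff_trunc, hn, show n < m + 1 + 1 by omega]

lemma map_ofPowerSeries (φ : R →+* S) (m : ℕ) :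
    (map φ m).comp (ofPowerSeries R m) = (ofPowerSeries S m).comp (PowerSeries.map φ) := by
  ext f
  refine mk_eq_mk.2 fun n hn ↦ ?_
  simp [PowerSeries.coeff_trunc, hn]

lemma exists_ringHom_powerSeries {A : Type u} [CommRing A] (g : ∀ m, A →+* TruncPoly R m)
    (hg : ∀ m, (res R m).comp (g (m + 1)) = g m) :
    ∃ G : A →+* PowerSeries R, ∀ m, (ofPowerSeries R m).comp G = g m := by
  choose G hG using fun a ↦ exists_powerSeries (fun m ↦ g m a)
    (fun m ↦ RingHom.congr_fun (hg m) a)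
  refine ⟨⟨⟨⟨G, ?_⟩, ?_⟩, ?_, ?_⟩, fun m ↦ RingHom.ext fun a ↦ hG a m⟩ <;> intros <;>
    refine ofPowerSeries_jointly_injective fun m ↦ ?_ <;> simp [hG]

end TruncPoly

/-- `Spec R[t]/(t^{m+1})`. -/
abbrev fatPoint (R : Type u) [CommRing R] (m : ℕ) : Scheme.{u} := Spec (.of (TruncPoly R m))

/-- The closed immersion `Spec R[t]/(t^{m+1}) → Spec R[t]/(t^{m+2})`. -/
def fatPointι (R : Type u) [CommRing R] (m : ℕ) : fatPoint R m ⟶ fatPoint R (m + 1) :=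
  Spec.map (CommRingCat.ofHom (TruncPoly.res R m))

/-- The structure morphism `Spec R[t]/(t^{m+1}) → Spec R`. -/
def fatPointToBase (R : Type u) [CommRing R] (m : ℕ) : fatPoint R m ⟶ Spec (.of R) :=
  Spec.map (CommRingCat.ofHom (TruncPoly.const R m))

/-- The point `t = 0`. -/
def fatPointZero (R : Type u) [CommRing R] (m : ℕ) : Spec (.of R) ⟶ fatPoint R m :=
  Spec.map (CommRingCat.ofHom (TruncPoly.evalZero R m))

@[simp]
lemma fatPointZero_ι (R : Type u) [CommRing R] (m : ℕ) :
    fatPointZero R m ≫ fatPointι R m = fatPointZero R (m + 1) := by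
  rw [fatPointZero, fatPointι, ← Spec.map_comp, ← CommRingCat.ofHom_comp,
    TruncPoly.evalZero_res, fatPointZero]

@[simp]
lemma fatPointι_toBase (R : Type u) [CommRing R] (m : ℕ) :
    fatPointι R m ≫ fatPointToBase R (m + 1) = fatPointToBase R m := by
  rw [fatPointToBase, fatPointι, ← Spec.map_comp, ← CommRingCat.ofHom_comp,
    TruncPoly.res_const, fatPointToBase]

instance (R : Type u) [CommRing R] (m : ℕ) : Surjective (fatPointZero R m) := by
  refine ⟨fun p ↦ ?_⟩
  have : p ∈ Set.range (PrimeSpectrum.comap (TruncPoly.evalZero R m)) := by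
    rw [range_comap_of_surjective _ _ (TruncPoly.evalZero_surjective m)]
    intro x hx
    obtain ⟨n, hn⟩ := TruncPoly.isNilpotent_of_evalZero ((RingHom.mem_ker).1 hx)
    exact p.2.mem_of_pow_mem n (hn ▸ zero_mem _)
  exact this

/-! ### Arcs on schemes over a base ring -/

section RelativeArcs

variable {k : Type u} [CommRing k]

/-- `T ×_k Spec k[t]/(t^{m+1})`. For `T = Spec R` this is `Spec R[t]/(t^{m+1})`. -/
def jetDomain (T : Over (Spec (.of k))) (m : ℕ) : Scheme.{u} :=
  pullback T.hom (fatPointToBase k m)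

namespace jetDomain

/-- The projection to `T`. -/
def fst (T : Over (Spec (.of k))) (m : ℕ) : jetDomain T m ⟶ T.left := pullback.fst _ _

/-- The projection to `Spec k[t]/(t^{m+1})`. -/
def snd (T : Over (Spec (.of k))) (m : ℕ) : jetDomain T m ⟶ fatPoint k m := pullback.snd _ _

variable {T T' T'' : Over (Spec (.of k))} {W : Scheme.{u}} {m : ℕ}

lemma isPullback (T : Over (Spec (.of k))) (m : ℕ) :
    IsPullback (fst T m) (snd T m) T.hom (fatPointToBase k m) := IsPullback.of_hasPullback _ _

/-- The universal property of the fiber product. -/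
def lift (f : W ⟶ T.left) (g : W ⟶ fatPoint k m) (h : f ≫ T.hom = g ≫ fatPointToBase k m) :
    W ⟶ jetDomain T m := pullback.lift f g h

@[simp]
lemma lift_fst (f : W ⟶ T.left) (g : W ⟶ fatPoint k m)
    (h : f ≫ T.hom = g ≫ fatPointToBase k m) : lift f g h ≫ fst T m = f :=
  pullback.lift_fst _ _ _

@[simp]
lemma lift_snd (f : W ⟶ T.left) (g : W ⟶ fatPoint k m)
    (h : f ≫ T.hom = g ≫ fatPointToBase k m) : lift f g h ≫ snd T m = g :=
  pullback.lift_snd _ _ _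

lemma hom_ext {a b : W ⟶ jetDomain T m} (h₁ : a ≫ fst T m = b ≫ fst T m)
    (h₂ : a ≫ snd T m = b ≫ snd T m) : a = b := pullback.hom_ext h₁ h₂

/-- Functoriality of `T ×_k Spec k[t]/(t^{m+1})` in `T`. -/
def map (f : T ⟶ T') (m : ℕ) : jetDomain T m ⟶ jetDomain T' m :=
  lift (fst T m ≫ f.left) (snd T m) (by rw [Category.assoc, Over.w, (isPullback T m).w])

@[simp]
lemma map_fst (f : T ⟶ T') : map f m ≫ fst T' m = fst T m ≫ f.left := lift_fst _ _ _

@[simp]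
lemma map_snd (f : T ⟶ T') : map f m ≫ snd T' m = snd T m := lift_snd _ _ _

/-- The closed immersion `T ×_k Spec k[t]/(t^{m+1}) ⟶ T ×_k Spec k[t]/(t^{m+2})`. -/
def ι (T : Over (Spec (.of k))) (m : ℕ) : jetDomain T m ⟶ jetDomain T (m + 1) :=
  lift (fst T m) (snd T m ≫ fatPointι k m)
    (by rw [Category.assoc, fatPointι_toBase, (isPullback T m).w])

@[simp]
lemma ι_fst : ι T m ≫ fst T (m + 1) = fst T m := lift_fst _ _ _

@[simp]
lemma ι_snd : ι T m ≫ snd T (m + 1) = snd T m ≫ fatPointι k m := lift_snd _ _ _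

lemma map_ι (f : T ⟶ T') : ι T m ≫ map f (m + 1) = map f m ≫ ι T' m := by
  refine hom_ext ?_ ?_
  · rw [Category.assoc, map_fst, ← Category.assoc, ι_fst, Category.assoc, ι_fst, map_fst]
  · rw [Category.assoc, map_snd, ι_snd, Category.assoc, ι_snd, ← Category.assoc, map_snd]

lemma map_id : map (𝟙 T) m = 𝟙 _ := by
  refine hom_ext ?_ ?_
  · rw [map_fst, Over.id_left, Category.comp_id, Category.id_comp]
  · rw [map_snd, Category.id_comp]

lemma map_comp (f : T ⟶ T') (g : T' ⟶ T'') : map (f ≫ g) m = map f m ≫ map g m := by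
  refine hom_ext ?_ ?_
  · rw [map_fst, Category.assoc, map_fst, ← Category.assoc, map_fst, Over.comp_left,
      Category.assoc]
  · rw [map_snd, Category.assoc, map_snd, map_snd]

end jetDomain

/-- An arc on the `k`-scheme `X` parametrized by the `k`-scheme `T`: an element of
`lim_m Hom_k(T ×_k Spec k[t]/(t^{m+1}), X)`. -/
@[ext]
structure Arc (X T : Over (Spec (.of k))) : Type u where
  /-- The `m`-jet of the arc. -/
  jet : ∀ m : ℕ, jetDomain T m ⟶ X.left
  /-- Every jet is a morphism of schemes over `k`. -/
  jet_over : ∀ m : ℕ, jet m ≫ X.hom = jetDomain.fst T m ≫ T.hom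
  /-- The jets are compatible. -/
  ι_jet : ∀ m : ℕ, jetDomain.ι T m ≫ jet (m + 1) = jet m

variable {X Y T T' T'' : Over (Spec (.of k))}

/-- Restriction of an arc along a morphism of parameter schemes. -/
@[simps]
def Arc.pull (f : T' ⟶ T) (a : Arc X T) : Arc X T' where
  jet m := jetDomain.map f m ≫ a.jet m
  jet_over m := by
    rw [Category.assoc, a.jet_over, ← Category.assoc, jetDomain.map_fst, Category.assoc, Over.w]
  ι_jet m := by rw [← Category.assoc, jetDomain.map_ι, Category.assoc, a.ι_jet]

/-- Composition of an arc with a morphism of schemes. -/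
@[simps]
def Arc.push (a : Arc X T) (f : X ⟶ Y) : Arc Y T where
  jet m := a.jet m ≫ f.left
  jet_over m := by rw [Category.assoc, Over.w, a.jet_over]
  ι_jet m := by rw [← Category.assoc, a.ι_jet]

lemma Arc.pull_id (a : Arc X T) : a.pull (𝟙 T) = a := by
  ext1
  ext1 m
  rw [pull_jet, jetDomain.map_id, Category.id_comp]

lemma Arc.pull_comp (f : T'' ⟶ T') (g : T' ⟶ T) (a : Arc X T) :
    a.pull (f ≫ g) = (a.pull g).pull f := by
  ext1
  ext1 m
  rw [pull_jet, pull_jet, pull_jet, jetDomain.map_comp, Category.assoc]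

/-- The functor of arcs on the `k`-scheme `X`. -/
def arcFunctor (X : Over (Spec (.of k))) : (Over (Spec (.of k)))ᵒᵖ ⥤ Type u where
  obj T := Arc X T.unop
  map f := ↾fun a ↦ a.pull f.unop
  map_id _ := ConcreteCategory.hom_ext _ _ fun a ↦ Arc.pull_id a
  map_comp _ _ := ConcreteCategory.hom_ext _ _ fun a ↦ Arc.pull_comp _ _ a

end RelativeArcs

/-! ### Existence of the arc space

The functor of arcs is shown to be representable: first over `ℤ`, by gluing the spectra of the
Hasse--Schmidt algebras of affine open subschemes, then over `k`, as a fiber product. -/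

section HS

variable (A : Type u) [CommRing A]

/-- The generic power series `∑ a_n t^n` over the polynomial ring in the symbols `a_n`. -/
def genericSeries (a : A) : PowerSeries (MvPolynomial (A × ℕ) ℤ) :=
  PowerSeries.mk fun n ↦ MvPolynomial.X (a, n)

/-- The relations of the algebra of Hasse--Schmidt derivations. -/
def hsIdeal : Ideal (MvPolynomial (A × ℕ) ℤ) :=
  Ideal.span {c | ∃ (n : ℕ) (d : PowerSeries (MvPolynomial (A × ℕ) ℤ)),
    c = PowerSeries.coeff n d ∧ (d = genericSeries A 1 - 1 ∨ ∃ a b : A,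
      d = genericSeries A (a + b) - (genericSeries A a + genericSeries A b) ∨
      d = genericSeries A (a * b) - genericSeries A a * genericSeries A b)}

/-- The algebra of Hasse--Schmidt derivations of the ring `A` (over `ℤ`). -/
abbrev HS : Type u := MvPolynomial (A × ℕ) ℤ ⧸ hsIdeal A

lemma map_mk_eq_zero (d : PowerSeries (MvPolynomial (A × ℕ) ℤ))
    (h : ∀ n, PowerSeries.coeff n d ∈ hsIdeal A) :
    PowerSeries.map (Ideal.Quotient.mk (hsIdeal A)) d = 0 := by
  ext n
  simpa using Ideal.Quotient.eq_zero_iff_mem.2 (h n)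

/-- The universal ring homomorphism `A → HS(A)[[t]]`. -/
def hsUniv : A →+* PowerSeries (HS A) :=
  RingHom.mk' ⟨⟨fun a ↦ PowerSeries.map (Ideal.Quotient.mk (hsIdeal A)) (genericSeries A a), by
    rw [← sub_eq_zero, ← map_one (PowerSeries.map (Ideal.Quotient.mk (hsIdeal A))), ← map_sub]
    exact map_mk_eq_zero A _ fun n ↦ Ideal.subset_span ⟨n, _, rfl, .inl rfl⟩⟩, fun a b ↦ by
    dsimp only
    rw [← map_mul, ← sub_eq_zero, ← map_sub]
    exact map_mk_eq_zero A _ fun n ↦ Ideal.subset_span ⟨n, _, rfl, .inr ⟨a, b, .inr rfl⟩⟩⟩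
    fun a b ↦ by
    dsimp
    rw [← map_add, ← sub_eq_zero, ← map_sub]
    exact map_mk_eq_zero A _ fun n ↦ Ideal.subset_span ⟨n, _, rfl, .inr ⟨a, b, .inl rfl⟩⟩

lemma hsUniv_apply (a : A) :
    hsUniv A a = PowerSeries.map (Ideal.Quotient.mk (hsIdeal A)) (genericSeries A a) := rfl

variable {A} {R : Type u} [CommRing R]

lemma exists_hs_lift (g : A →+* PowerSeries R) :
    ∃ h : HS A →+* R, (PowerSeries.map h).comp (hsUniv A) = g := by
  let e : MvPolynomial (A × ℕ) ℤ →+* R :=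
    MvPolynomial.eval₂Hom (Int.castRingHom R) fun x ↦ PowerSeries.coeff x.2 (g x.1)
  have he (a : A) : PowerSeries.map e (genericSeries A a) = g a := by
    ext n
    simp [genericSeries, e]
  refine ⟨Ideal.Quotient.lift _ e ?_, ?_⟩
  · intro c hc
    rw [← RingHom.mem_ker]
    revert c
    change hsIdeal A ≤ _
    rw [hsIdeal, Ideal.span_le]
    rintro _ ⟨n, d, rfl, hd⟩
    rw [SetLike.mem_coe, RingHom.mem_ker, ← PowerSeries.coeff_map]
    obtain rfl | ⟨a, b, rfl | rfl⟩ := hd <;> simp [he]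
  · ext a n
    simp [hsUniv_apply, genericSeries, e]

lemma hs_hom_ext {h h' : HS A →+* R}
    (e : (PowerSeries.map h).comp (hsUniv A) = (PowerSeries.map h').comp (hsUniv A)) :
    h = h' := by
  refine Ideal.Quotient.ringHom_ext (MvPolynomial.ringHom_ext (by simp) fun x ↦ ?_)
  have := congr(PowerSeries.coeff x.2 ($e x.1))
  simpa [hsUniv_apply, genericSeries] using this

end HS

/-- `T × Spec ℤ[t]/(t^{m+1})`. -/
def thick (T : Scheme.{u}) (m : ℕ) : Scheme.{u} :=
  pullback (specULiftZIsTerminal.from T) (fatPointToBase (ULift.{u} ℤ) m)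

namespace thick

def fst (T : Scheme.{u}) (m : ℕ) : thick T m ⟶ T := pullback.fst _ _

def snd (T : Scheme.{u}) (m : ℕ) : thick T m ⟶ fatPoint (ULift.{u} ℤ) m := pullback.snd _ _

variable {T T' T'' W W' : Scheme.{u}} {m : ℕ}

lemma isPullback (T : Scheme.{u}) (m : ℕ) :
    IsPullback (fst T m) (snd T m) (specULiftZIsTerminal.from T)
      (fatPointToBase (ULift.{u} ℤ) m) := IsPullback.of_hasPullback _ _

def lift (f : W ⟶ T) (g : W ⟶ fatPoint (ULift.{u} ℤ) m) : W ⟶ thick T m :=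
  pullback.lift f g (specULiftZIsTerminal.hom_ext _ _)

@[simp]
lemma lift_fst (f : W ⟶ T) (g : W ⟶ fatPoint (ULift.{u} ℤ) m) : lift f g ≫ fst T m = f :=
  pullback.lift_fst _ _ _

@[simp]
lemma lift_fst_assoc (f : W ⟶ T) (g : W ⟶ fatPoint (ULift.{u} ℤ) m) {Z : Scheme.{u}} (h : T ⟶ Z) :
    lift f g ≫ fst T m ≫ h = f ≫ h := by
  simp only [← Category.assoc, lift_fst]

@[simp]
lemma lift_snd (f : W ⟶ T) (g : W ⟶ fatPoint (ULift.{u} ℤ) m) : lift f g ≫ snd T m = g :=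
  pullback.lift_snd _ _ _

@[simp]
lemma lift_snd_assoc (f : W ⟶ T) (g : W ⟶ fatPoint (ULift.{u} ℤ) m) {Z : Scheme.{u}}
    (h : fatPoint (ULift.{u} ℤ) m ⟶ Z) : lift f g ≫ snd T m ≫ h = g ≫ h := by
  simp only [← Category.assoc, lift_snd]

lemma hom_ext {a b : W ⟶ thick T m} (h₁ : a ≫ fst T m = b ≫ fst T m)
    (h₂ : a ≫ snd T m = b ≫ snd T m) : a = b := pullback.hom_ext h₁ h₂

@[simp]
lemma comp_lift (h : W' ⟶ W) (f : W ⟶ T) (g : W ⟶ fatPoint (ULift.{u} ℤ) m) :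
    h ≫ lift f g = lift (h ≫ f) (h ≫ g) := hom_ext (by simp) (by simp)

@[simp]
lemma comp_lift_assoc (h : W' ⟶ W) (f : W ⟶ T) (g : W ⟶ fatPoint (ULift.{u} ℤ) m) {Z : Scheme.{u}}
    (a : thick T m ⟶ Z) : h ≫ lift f g ≫ a = lift (h ≫ f) (h ≫ g) ≫ a := by
  simp only [← Category.assoc, comp_lift]

lemma lift_fst_snd : lift (fst T m) (snd T m) = 𝟙 _ := hom_ext (by simp) (by simp)

def map (f : T ⟶ T') (m : ℕ) : thick T m ⟶ thick T' m := lift (fst T m ≫ f) (snd T m)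

@[simp]
lemma map_fst (f : T ⟶ T') : map f m ≫ fst T' m = fst T m ≫ f := lift_fst _ _

@[simp]
lemma map_fst_assoc (f : T ⟶ T') {Z : Scheme.{u}} (h : T' ⟶ Z) :
    map f m ≫ fst T' m ≫ h = fst T m ≫ f ≫ h := by
  simp only [← Category.assoc, map_fst]

@[simp]
lemma map_snd (f : T ⟶ T') : map f m ≫ snd T' m = snd T m := lift_snd _ _

@[simp]
lemma map_snd_assoc (f : T ⟶ T') {Z : Scheme.{u}} (h : fatPoint (ULift.{u} ℤ) m ⟶ Z) :
    map f m ≫ snd T' m ≫ h = snd T m ≫ h := by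
  simp only [← Category.assoc, map_snd]

@[simp]
lemma lift_map (f : W ⟶ T) (g : W ⟶ fatPoint (ULift.{u} ℤ) m) (h : T ⟶ T') :
    lift f g ≫ map h m = lift (f ≫ h) g := hom_ext (by simp) (by simp)

@[simp]
lemma lift_map_assoc (f : W ⟶ T) (g : W ⟶ fatPoint (ULift.{u} ℤ) m) (h : T ⟶ T') {Z : Scheme.{u}}
    (a : thick T' m ⟶ Z) : lift f g ≫ map h m ≫ a = lift (f ≫ h) g ≫ a := by
  simp only [← Category.assoc, lift_map]

@[simp]
lemma map_id : map (𝟙 T) m = 𝟙 _ := hom_ext (by simp) (by simp)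

lemma map_comp (f : T ⟶ T') (g : T' ⟶ T'') : map (f ≫ g) m = map f m ≫ map g m :=
  hom_ext (by simp) (by simp)

def ι (T : Scheme.{u}) (m : ℕ) : thick T m ⟶ thick T (m + 1) :=
  lift (fst T m) (snd T m ≫ fatPointι _ m)

@[simp]
lemma ι_fst : ι T m ≫ fst T (m + 1) = fst T m := lift_fst _ _

@[simp]
lemma ι_fst_assoc {Z : Scheme.{u}} (h : T ⟶ Z) : ι T m ≫ fst T (m + 1) ≫ h = fst T m ≫ h := by
  simp only [← Category.assoc, ι_fst]

@[simp]
lemma ι_snd : ι T m ≫ snd T (m + 1) = snd T m ≫ fatPointι _ m := lift_snd _ _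

lemma map_ι (f : T ⟶ T') : map f m ≫ ι T' m = ι T m ≫ map f (m + 1) :=
  hom_ext (by simp) (by simp)

lemma map_ι_assoc (f : T ⟶ T') {Z : Scheme.{u}} (h : thick T' (m + 1) ⟶ Z) :
    map f m ≫ ι T' m ≫ h = ι T m ≫ map f (m + 1) ≫ h := by
  simp only [← Category.assoc, map_ι]

def zero (T : Scheme.{u}) (m : ℕ) : T ⟶ thick T m :=
  lift (𝟙 _) (specULiftZIsTerminal.from T ≫ fatPointZero _ m)

@[simp]
lemma zero_fst : zero T m ≫ fst T m = 𝟙 _ := lift_fst _ _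

@[simp]
lemma zero_fst_assoc {Z : Scheme.{u}} (h : T ⟶ Z) : zero T m ≫ fst T m ≫ h = h := by
  simp only [← Category.assoc, zero_fst, Category.id_comp]

@[simp]
lemma zero_snd : zero T m ≫ snd T m = specULiftZIsTerminal.from T ≫ fatPointZero _ m :=
  lift_snd _ _

@[simp]
lemma zero_ι : zero T m ≫ ι T m = zero T (m + 1) := hom_ext (by simp) (by
    rw [Category.assoc, ι_snd, ← Category.assoc, zero_snd, Category.assoc, fatPointZero_ι,
      zero_snd])

@[simp]
lemma zero_ι_assoc {Z : Scheme.{u}} (h : thick T (m + 1) ⟶ Z) :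
    zero T m ≫ ι T m ≫ h = zero T (m + 1) ≫ h := by
  simp only [← Category.assoc, zero_ι]

@[simp]
lemma zero_map (f : T ⟶ T') : zero T m ≫ map f m = f ≫ zero T' m :=
  hom_ext (by simp) (by
    simp only [Category.assoc, map_snd, zero_snd]
    rw [← Category.assoc]
    congr 1
    exact specULiftZIsTerminal.hom_ext _ _)

@[simp]
lemma zero_map_assoc (f : T ⟶ T') {Z : Scheme.{u}} (h : thick T' m ⟶ Z) :
    zero T m ≫ map f m ≫ h = f ≫ zero T' m ≫ h := by
  simp only [← Category.assoc, zero_map]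

instance : Surjective (zero T m) := by
  have : IsPullback (zero T m) (specULiftZIsTerminal.from T) (snd T m)
      (fatPointZero (ULift.{u} ℤ) m) := by
    refine ⟨⟨by simp⟩, ⟨PullbackCone.IsLimit.mk _ (fun s ↦ s.fst ≫ fst T m) (fun s ↦ ?_)
      (fun s ↦ specULiftZIsTerminal.hom_ext _ _) (fun s f h₁ h₂ ↦ ?_)⟩⟩
    · refine hom_ext (by simp) ?_
      rw [s.condition, Category.assoc, zero_snd, ← Category.assoc]
      congr 1
      exact specULiftZIsTerminal.hom_ext _ _
    · rw [← h₁]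
      simp
  exact MorphismProperty.of_isPullback this.flip (inferInstanceAs (Surjective (fatPointZero _ m)))

end thick

/-- A `T`-valued absolute arc on `X`: a compatible family of jets. -/
@[ext]
structure AbsArc (X T : Scheme.{u}) : Type u where
  jet : ∀ m, thick T m ⟶ X
  ι_jet : ∀ m, thick.ι T m ≫ jet (m + 1) = jet m

namespace AbsArc

variable {X Y Z T T' T'' : Scheme.{u}}

attribute [simp] ι_jet

@[simps]
def pull (f : T' ⟶ T) (g : AbsArc X T) : AbsArc X T' where
  jet m := thick.map f m ≫ g.jet m
  ι_jet m := by rw [← thick.map_ι_assoc, g.ι_jet]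

@[simps]
def push (g : AbsArc X T) (f : X ⟶ Y) : AbsArc Y T where
  jet m := g.jet m ≫ f
  ι_jet m := by rw [← Category.assoc, g.ι_jet]

@[simp]
lemma pull_id (g : AbsArc X T) : g.pull (𝟙 T) = g := by
  ext m
  simp

lemma pull_comp (f : T'' ⟶ T') (h : T' ⟶ T) (g : AbsArc X T) :
    g.pull (f ≫ h) = (g.pull h).pull f := by
  ext m
  simp [thick.map_comp]

lemma pull_push (f : T' ⟶ T) (g : AbsArc X T) (h : X ⟶ Y) :
    (g.pull f).push h = (g.push h).pull f := by
  ext m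
  simp

end AbsArc

/-- The functor of (absolute) arcs on a scheme. -/
def absArc (X : Scheme.{u}) : Scheme.{u}ᵒᵖ ⥤ Type u where
  obj T := AbsArc X T.unop
  map {T T'} f := ↾fun g ↦ g.pull f.unop
  map_id T := ConcreteCategory.hom_ext _ _ fun g ↦ AbsArc.pull_id g
  map_comp f g := ConcreteCategory.hom_ext _ _ fun x ↦ AbsArc.pull_comp _ _ x

lemma absArc_map (X : Scheme.{u}) {T T' : Scheme.{u}ᵒᵖ} (f : T ⟶ T') (g : AbsArc X T.unop) :
    (absArc X).map f g = g.pull f.unop := rfl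

/-- Functoriality of absolute arcs. -/
def absArcMap {X Y : Scheme.{u}} (f : X ⟶ Y) : absArc X ⟶ absArc Y where
  app T := ↾fun g ↦ AbsArc.push g f
  naturality T T' h := ConcreteCategory.hom_ext _ _ fun x ↦ AbsArc.pull_push _ _ _

lemma absArcMap_app {X Y : Scheme.{u}} (f : X ⟶ Y) {T : Scheme.{u}ᵒᵖ} (g : AbsArc X T.unop) :
    (absArcMap f).app T g = g.push f := rfl

lemma absArc_isSheaf (X : Scheme.{u}) :
    Presieve.IsSheaf Scheme.zariskiTopology (absArc X) := by
  intro T R hR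
  have hX := (Scheme.zariskiTopology.yoneda.obj X).property
  rw [isSheaf_iff_isSheaf_of_type] at hX
  have hp (m : ℕ) := hX (R.pullback (thick.fst T m))
    (Scheme.zariskiTopology.pullback_stable _ hR)
  intro x hx
  rw [Presieve.compatible_iff_sieveCompatible] at hx
  replace hx {U V : Scheme.{u}} (f : U ⟶ T) (g : V ⟶ U) (hf : R f) (m : ℕ) :
      (x (g ≫ f) (R.downward_closed hf g)).jet m = thick.map g m ≫ (x f hf).jet m :=
    congr(($(hx f g hf)).jet m)
  let y (m : ℕ) : Presieve.FamilyOfElements (yoneda.obj X)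
      (R.pullback (thick.fst T m)).arrows :=
    fun W q hq ↦ thick.lift (𝟙 W) (q ≫ thick.snd T m) ≫ (x (q ≫ thick.fst T m) hq).jet m
  have hxj {U : Scheme.{u}} {f g : U ⟶ T} (h : f = g) (hf : R f) (m : ℕ) :
      (x f hf).jet m = (x g (h ▸ hf)).jet m := by subst h; rfl
  have hy (m : ℕ) : (y m).Compatible := by
    rw [Presieve.compatible_iff_sieveCompatible]
    intro W W' q h hq
    have := hx (q ≫ thick.fst T m) h hq m
    change thick.lift (𝟙 W') ((h ≫ q) ≫ thick.snd T m) ≫ (x ((h ≫ q) ≫ thick.fst T m) _).jet m =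
      h ≫ thick.lift (𝟙 W) (q ≫ thick.snd T m) ≫ (x (q ≫ thick.fst T m) hq).jet m
    rw [show (x ((h ≫ q) ≫ thick.fst T m) ((R.pullback _).downward_closed hq h)).jet m =
      thick.map h m ≫ (x (q ≫ thick.fst T m) hq).jet m from
        (hxj (Category.assoc h q _) _ m).trans this]
    simp
  choose g hg hg' using fun m ↦ hp m (y m) (hy m)
  have hg2 (m : ℕ) {U : Scheme.{u}} (f : U ⟶ T) (hf : R f) :
      thick.map f m ≫ g m = (x f hf).jet m := by
    have hq : R (thick.map f m ≫ thick.fst T m) := by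
      rw [thick.map_fst]; exact R.downward_closed hf _
    refine (hg m (thick.map f m) hq).trans ?_
    change thick.lift (𝟙 _) (thick.map f m ≫ thick.snd T m) ≫
      (x (thick.map f m ≫ thick.fst T m) _).jet m = _
    rw [show (x (thick.map f m ≫ thick.fst T m) hq).jet m =
      thick.map (thick.fst U m) m ≫ (x f hf).jet m from
        (hxj (thick.map_fst f) _ m).trans (hx f (thick.fst U m) hf m)]
    simp [thick.lift_fst_snd]
  have hsep (m : ℕ) (a b : thick T m ⟶ X)
      (h : ∀ {U : Scheme.{u}} (f : U ⟶ T), R f → thick.map f m ≫ a = thick.map f m ≫ b) :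
      a = b := by
    refine (hp m).isSeparatedFor.ext fun W q hq ↦ ?_
    have := h _ hq
    have e : q = thick.lift (𝟙 W) (q ≫ thick.snd T m) ≫ thick.map (q ≫ thick.fst T m) m :=
      thick.hom_ext (by simp) (by simp)
    change q ≫ a = q ≫ b
    rw [e, Category.assoc, this, Category.assoc]
  refine ⟨⟨g, fun m ↦ hsep m _ _ fun {U} f hf ↦ ?_⟩, fun U f hf ↦ ?_, fun g' hg'' ↦ ?_⟩
  · rw [hg2 m f hf, thick.map_ι_assoc]
    erw [hg2 (m + 1) f hf]
    exact (x f hf).ι_jet m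
  · exact AbsArc.ext (funext fun m ↦ hg2 m f hf)
  · refine AbsArc.ext (funext fun m ↦ hsep m _ _ fun {U} f hf ↦ ?_)
    have := hg2 m f hf
    rw [← hg'' f hf] at this
    exact this.symm

section Affine

variable (R S : Type u) [CommRing R] [CommRing S]

def intTo (R : Type u) [CommRing R] : ULift.{u} ℤ →+* R :=
  (Int.castRingHom R).comp ULift.ringEquiv.toRingHom

/-- For affine `T = Spec R`, the thickening `thick T m` is `Spec R[t]/(t^{m+1})`. -/
def thickSpec (m : ℕ) : fatPoint R m ⟶ thick (Spec (.of R)) m :=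
  thick.lift (fatPointToBase R m) (Spec.map (CommRingCat.ofHom (TruncPoly.map (intTo R) m)))

instance (m : ℕ) : IsIso (thickSpec R m) := by
  have h := isPullback_SpecMap_of_isPushout _ _ _ _
    (TruncPoly.isPushout (CommRingCat.ofHom (intTo R)) m)
  have e : specULiftZIsTerminal.from _ = Spec.map (CommRingCat.ofHom (intTo R)) :=
    specULiftZIsTerminal.hom_ext _ _
  have h' := thick.isPullback (Spec (.of R)) m
  rw [e] at h'
  have : thickSpec R m = (h.isoIsPullback _ _ h').hom :=
    thick.hom_ext
      ((thick.lift_fst _ _).trans (IsPullback.isoIsPullback_hom_fst _ _ h h').symm)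
      ((thick.lift_snd _ _).trans (IsPullback.isoIsPullback_hom_snd _ _ h h').symm)
  rw [this]
  infer_instance

variable {R S}

lemma thickSpec_map (φ : R →+* S) (m : ℕ) :
    thickSpec S m ≫ thick.map (Spec.map (CommRingCat.ofHom φ)) m =
      Spec.map (CommRingCat.ofHom (TruncPoly.map φ m)) ≫ thickSpec R m := by
  refine thick.hom_ext ?_ ?_
  · simp only [thickSpec, thick.lift_map, thick.lift_fst, Category.assoc, fatPointToBase,
      ← Spec.map_comp, ← CommRingCat.ofHom_comp, TruncPoly.map_const]
  · simp only [thickSpec, thick.lift_map, thick.lift_snd, Category.assoc,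
      ← Spec.map_comp, ← CommRingCat.ofHom_comp]
    congr 2
    refine TruncPoly.hom_ext ?_ (by simp [TruncPoly.map])
    ext x
    simp [TruncPoly.map, TruncPoly.const, intTo]

lemma thickSpec_ι (m : ℕ) :
    fatPointι R m ≫ thickSpec R (m + 1) = thickSpec R m ≫ thick.ι _ m := by
  refine thick.hom_ext ?_ ?_
  · simp [thickSpec]
  · simp only [thickSpec, thick.lift_snd, Category.assoc, fatPointι, thick.ι_snd,
      thick.lift_snd_assoc,
      ← Spec.map_comp, ← CommRingCat.ofHom_comp, TruncPoly.map_res]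

lemma thickSpec_ι_assoc (m : ℕ) {Z : Scheme.{u}} (h : thick (Spec (.of R)) (m + 1) ⟶ Z) :
    fatPointι R m ≫ thickSpec R (m + 1) ≫ h = thickSpec R m ≫ thick.ι _ m ≫ h := by
  rw [← Category.assoc, thickSpec_ι, Category.assoc]

variable (A : Type u) [CommRing A]

/-- The universal arc on an affine scheme. -/
def univArc : AbsArc (Spec (.of A)) (Spec (.of (HS A))) where
  jet m := inv (thickSpec (HS A) m) ≫
    Spec.map (CommRingCat.ofHom ((TruncPoly.ofPowerSeries _ m).comp (hsUniv A)))
  ι_jet m := by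
    rw [← cancel_epi (thickSpec (HS A) m), ← thickSpec_ι_assoc]
    simp only [IsIso.hom_inv_id_assoc, fatPointι, ← Spec.map_comp, ← CommRingCat.ofHom_comp,
      ← RingHom.comp_assoc, TruncPoly.res_ofPowerSeries]

variable {A}

lemma thickSpec_univArc (h : HS A →+* R) (m : ℕ) :
    thickSpec R m ≫ ((univArc A).pull (Spec.map (CommRingCat.ofHom h))).jet m =
      Spec.map (CommRingCat.ofHom
        ((TruncPoly.ofPowerSeries R m).comp ((PowerSeries.map h).comp (hsUniv A)))) := by
  rw [AbsArc.pull_jet, ← Category.assoc, thickSpec_map, univArc]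
  simp only [Category.assoc, IsIso.hom_inv_id_assoc, ← Spec.map_comp, ← CommRingCat.ofHom_comp,
    ← RingHom.comp_assoc, TruncPoly.map_ofPowerSeries]

lemma univArc_inj_affine {h h' : Spec (.of R) ⟶ Spec (.of (HS A))}
    (e : (univArc A).pull h = (univArc A).pull h') : h = h' := by
  obtain ⟨f, rfl⟩ := Spec.map_surjective h
  obtain ⟨f', rfl⟩ := Spec.map_surjective h'
  congr 1
  ext : 1
  refine hs_hom_ext (RingHom.ext fun a ↦ TruncPoly.ofPowerSeries_jointly_injective fun m ↦ ?_)
  have h1 := thickSpec_univArc f.hom m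
  have h2 := thickSpec_univArc f'.hom m
  rw [CommRingCat.ofHom_hom] at h1 h2
  rw [e, h2] at h1
  exact congr($(Spec.map_injective h1).hom a).symm

lemma univArc_surj_affine (g : AbsArc (Spec (.of A)) (Spec (.of R))) :
    ∃ h, (univArc A).pull h = g := by
  choose γ hγ using fun m ↦ Spec.map_surjective (thickSpec R m ≫ g.jet m)
  have hc (m : ℕ) : (TruncPoly.res R m).comp (γ (m + 1)).hom = (γ m).hom := by
    have : γ (m + 1) ≫ CommRingCat.ofHom (TruncPoly.res R m) = γ m := by
      apply Spec.map_injective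
      rw [Spec.map_comp, hγ, hγ, ← g.ι_jet m, ← thickSpec_ι_assoc]
      rfl
    exact congr($(this).hom)
  obtain ⟨G, hG⟩ := TruncPoly.exists_ringHom_powerSeries (fun m ↦ (γ m).hom) hc
  obtain ⟨h, hh⟩ := exists_hs_lift G
  refine ⟨Spec.map (CommRingCat.ofHom h), AbsArc.ext (funext fun m ↦ ?_)⟩
  rw [← cancel_epi (thickSpec R m), thickSpec_univArc, hh, hG, ← hγ, CommRingCat.ofHom_hom]

lemma AbsArc.ext_cover {X T : Scheme.{u}} (𝒰 : T.OpenCover) {a b : AbsArc X T}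
    (h : ∀ i, a.pull (𝒰.f i) = b.pull (𝒰.f i)) : a = b := by
  refine ((absArc_isSheaf X).isSheafFor _ 𝒰.mem_grothendieckTopology).isSeparatedFor.ext ?_
  rintro _ _ ⟨i⟩
  exact h i

lemma univArc_inj {T : Scheme.{u}} {h h' : T ⟶ Spec (.of (HS A))}
    (e : (univArc A).pull h = (univArc A).pull h') : h = h' := by
  refine T.affineOpenCover.openCover.hom_ext _ _ fun i ↦ ?_
  refine univArc_inj_affine (R := T.affineOpenCover.X i) ?_
  change (univArc A).pull (T.affineOpenCover.f i ≫ h) = (univArc A).pull (T.affineOpenCover.f i ≫ h')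
  rw [AbsArc.pull_comp, AbsArc.pull_comp, e]

lemma univArc_surj {T : Scheme.{u}} (g : AbsArc (Spec (.of A)) T) :
    ∃ h, (univArc A).pull h = g := by
  choose h hh using fun i ↦ univArc_surj_affine (R := T.affineOpenCover.X i)
    (g.pull (T.affineOpenCover.f i))
  have hc (i j) : pullback.fst (T.affineOpenCover.openCover.f i) (T.affineOpenCover.openCover.f j) ≫
      h i = pullback.snd (T.affineOpenCover.openCover.f i) (T.affineOpenCover.openCover.f j) ≫
        h j := by
    have := congr(g.pull $(pullback.condition (f := T.affineOpenCover.openCover.f i)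
      (g := T.affineOpenCover.openCover.f j)))
    rw [AbsArc.pull_comp, AbsArc.pull_comp] at this
    refine univArc_inj ?_
    refine (AbsArc.pull_comp _ _ _).trans ((Eq.trans ?_ this).trans ?_)
    · exact congr(AbsArc.pull _ $(hh i))
    · exact congr(AbsArc.pull _ $(hh j)).symm.trans (AbsArc.pull_comp _ _ _).symm
  refine ⟨T.affineOpenCover.openCover.glueMorphisms h hc, ?_⟩
  refine AbsArc.ext_cover T.affineOpenCover.openCover fun i ↦ ?_
  rw [← AbsArc.pull_comp]
  exact congr(AbsArc.pull $(Scheme.Cover.ι_glueMorphisms _ h hc i) _).trans (hh i)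

/-- Arcs on `Spec A` are represented by the spectrum of the Hasse--Schmidt algebra. -/
def affineRepresentableBy (A : Type u) [CommRing A] :
    (absArc (Spec (.of A))).RepresentableBy (Spec (.of (HS A))) where
  homEquiv := Equiv.ofBijective (fun h ↦ (univArc A).pull h)
    ⟨fun _ _ ↦ univArc_inj, univArc_surj⟩
  homEquiv_comp f g := AbsArc.pull_comp f g _

end Affine

section OpenImmersion

variable {U X T T' : Scheme.{u}}

/-- The point of `X` at which an arc starts. -/
def AbsArc.base (g : AbsArc X T) : T ⟶ X := thick.zero T 0 ≫ g.jet 0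

lemma AbsArc.zero_jet (g : AbsArc X T) (m : ℕ) : thick.zero T m ≫ g.jet m = g.base := by
  induction m with
  | zero => rfl
  | succ m ih => rw [← ih, ← thick.zero_ι, Category.assoc, g.ι_jet]

lemma AbsArc.base_pull (g : AbsArc X T) (f : T' ⟶ T) : (g.pull f).base = f ≫ g.base := by
  simp [base]

lemma AbsArc.base_push (g : AbsArc X T) (f : X ⟶ U) : (g.push f).base = g.base ≫ f := by
  simp [base]

lemma AbsArc.push_injective (j : U ⟶ X) [Mono j] {a b : AbsArc U T}
    (h : a.push j = b.push j) : a = b := by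
  refine AbsArc.ext (funext fun m ↦ ?_)
  rw [← cancel_mono j]
  exact congr(($h).jet m)

lemma AbsArc.exists_push (j : U ⟶ X) [IsOpenImmersion j] (g : AbsArc X T)
    (h : Set.range g.base ⊆ Set.range j) : ∃ g' : AbsArc U T, g'.push j = g := by
  have key (m : ℕ) : Set.range (g.jet m) ⊆ Set.range j := by
    rintro _ ⟨x, rfl⟩
    obtain ⟨t, rfl⟩ := (thick.zero T m).surjective x
    rw [← Scheme.Hom.comp_apply, g.zero_jet]
    exact h ⟨t, rfl⟩
  refine ⟨⟨fun m ↦ IsOpenImmersion.lift j (g.jet m) (key m), fun m ↦ ?_⟩,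
    AbsArc.ext (funext fun m ↦ ?_)⟩
  · rw [← cancel_mono j]
    simp
  · simp

lemma absArcMap_presheaf (j : U ⟶ X) [IsOpenImmersion j] :
    IsOpenImmersion.presheaf (absArcMap j) := by
  refine MorphismProperty.relative.of_exists fun T g ↦ ?_
  obtain ⟨g, rfl⟩ := yonedaEquiv.symm.surjective g
  change AbsArc X T at g
  let V : T.Opens := g.base ⁻¹ᵁ j.opensRange
  obtain ⟨g', hg'⟩ := AbsArc.exists_push j (g.pull V.ι) (by
    rw [AbsArc.base_pull]
    rintro _ ⟨x, rfl⟩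
    exact x.2)
  refine ⟨V, yonedaEquiv.symm g', V.ι, ?_, inferInstance⟩
  refine IsPullback.of_forall_isPullback_app fun W ↦ ?_
  rw [Types.isPullback_iff]
  refine ⟨ConcreteCategory.hom_ext _ _ fun (w : W.unop ⟶ V) ↦ ?_, fun x y h ↦ ?_, fun a b h ↦ ?_⟩
  · change (g'.pull w).push j = g.pull (w ≫ V.ι)
    rw [AbsArc.pull_push, hg', AbsArc.pull_comp]
  · exact (cancel_mono V.ι).1 h.2
  · change AbsArc U W.unop at a
    change W.unop ⟶ T at b
    change a.push j = g.pull b at h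
    have hr : Set.range b ⊆ Set.range V.ι := by
      rintro _ ⟨x, rfl⟩
      rw [Scheme.Opens.range_ι]
      change g.base (b x) ∈ Set.range j
      rw [← Scheme.Hom.comp_apply, ← AbsArc.base_pull, ← h, AbsArc.base_push]
      exact ⟨a.base x, rfl⟩
    refine ⟨IsOpenImmersion.lift V.ι b hr, AbsArc.push_injective j ?_,
      IsOpenImmersion.lift_fac _ _ _⟩
    change (g'.pull (IsOpenImmersion.lift V.ι b hr)).push j = a.push j
    rw [AbsArc.pull_push, hg', h, ← AbsArc.pull_comp, IsOpenImmersion.lift_fac]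

end OpenImmersion

instance absArc_isRepresentable (X : Scheme.{u}) : (absArc X).IsRepresentable := by
  let F : Sheaf Scheme.zariskiTopology.{u} (Type u) :=
    ⟨absArc X, (isSheaf_iff_isSheaf_of_type _ _).2 (absArc_isSheaf X)⟩
  obtain ⟨𝒰⟩ : Nonempty (Scheme.AffineOpenCover.{u} X) := ⟨X.affineOpenCover⟩
  let f (i : 𝒰.I₀) : yoneda.obj (Spec (.of (HS (𝒰.X i)))) ⟶ F.obj :=
    (affineRepresentableBy (𝒰.X i)).toIso.hom ≫ absArcMap (𝒰.f i)
  have hf (i : 𝒰.I₀) : IsOpenImmersion.presheaf (f i) :=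
    (MorphismProperty.cancel_left_of_respectsIso _ _ _).2 (absArcMap_presheaf (𝒰.f i))
  have : Presheaf.IsLocallySurjective Scheme.zariskiTopology (Sigma.desc f) := by
    refine ⟨fun {T} s ↦ ?_⟩
    change AbsArc X T at s
    refine GrothendieckTopology.superset_covering _ ?_
      (Scheme.Cover.mem_grothendieckTopology
        (𝒰.openCover.pullback₁ s.base : T.OpenCover))
    rw [Sieve.ofArrows, Sieve.generate_le_iff]
    rintro _ _ ⟨i⟩
    change 𝒰.I₀ at i
    obtain ⟨g', hg'⟩ := AbsArc.exists_push (𝒰.f i) (s.pull (pullback.fst s.base (𝒰.f i))) (by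
      rw [AbsArc.base_pull, pullback.condition]
      rintro _ ⟨x, rfl⟩
      exact ⟨_, rfl⟩)
    obtain ⟨h, hh⟩ := univArc_surj g'
    refine ⟨(Sigma.ι (fun i ↦ yoneda.obj (Spec (.of (HS (𝒰.X i))))) i).app _ h, ?_⟩
    have e := congr(($(Sigma.ι_desc f i)).app (op (pullback s.base (𝒰.f i))) h)
    refine e.trans (Eq.trans ?_ hg')
    change ((univArc (𝒰.X i)).pull h).push (𝒰.f i) = _
    exact congr(AbsArc.push $hh (𝒰.f i))
  exact Scheme.LocalRepresentability.isRepresentable (F := F) hf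

section Representability

variable {k : Type u} [CommRing k] {X Y T T' T'' : Over (Spec (.of k))}

section Comparison

/-- Comparison of thickenings over `k` and over `ℤ`. -/
def jetDomain.toThick (T : Over (Spec (.of k))) (m : ℕ) : jetDomain T m ⟶ thick T.left m :=
  thick.lift (fst T m) (snd T m ≫ Spec.map (CommRingCat.ofHom (TruncPoly.map (intTo k) m)))

instance (T : Over (Spec (.of k))) (m : ℕ) : IsIso (jetDomain.toThick T m) := by
  have h0 := (isPullback_SpecMap_of_isPushout _ _ _ _
      (TruncPoly.isPushout (CommRingCat.ofHom (intTo k)) m))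
  have h := (jetDomain.isPullback T m).paste_vert h0
  have e : specULiftZIsTerminal.from _ = T.hom ≫ Spec.map (CommRingCat.ofHom (intTo k)) :=
    specULiftZIsTerminal.hom_ext _ _
  have h' := thick.isPullback T.left m
  rw [e] at h'
  have : jetDomain.toThick T m = (h.isoIsPullback _ _ h').hom :=
    thick.hom_ext
      ((thick.lift_fst _ _).trans (IsPullback.isoIsPullback_hom_fst _ _ h h').symm)
      ((thick.lift_snd _ _).trans (IsPullback.isoIsPullback_hom_snd _ _ h h').symm)
  rw [this]
  infer_instance

@[simp]
lemma jetDomain.toThick_fst (T : Over (Spec (.of k))) (m : ℕ) :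
    toThick T m ≫ thick.fst T.left m = fst T m := thick.lift_fst _ _

@[simp]
lemma jetDomain.toThick_snd (T : Over (Spec (.of k))) (m : ℕ) :
    toThick T m ≫ thick.snd T.left m =
      snd T m ≫ Spec.map (CommRingCat.ofHom (TruncPoly.map (intTo k) m)) := thick.lift_snd _ _

lemma jetDomain.map_toThick (f : T ⟶ T') (m : ℕ) :
    map f m ≫ toThick T' m = toThick T m ≫ thick.map f.left m := by
  refine thick.hom_ext ?_ ?_
  · rw [Category.assoc, toThick_fst, map_fst, Category.assoc, thick.map_fst, ← Category.assoc,
      toThick_fst]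
  · rw [Category.assoc, toThick_snd, ← Category.assoc, map_snd, Category.assoc, thick.map_snd,
      toThick_snd]

lemma jetDomain.ι_toThick (T : Over (Spec (.of k))) (m : ℕ) :
    ι T m ≫ toThick T (m + 1) = toThick T m ≫ thick.ι T.left m := by
  refine thick.hom_ext ?_ ?_
  · rw [Category.assoc, toThick_fst, ι_fst, Category.assoc, thick.ι_fst, toThick_fst]
  · rw [Category.assoc, toThick_snd, ← Category.assoc, ι_snd, Category.assoc, Category.assoc,
      thick.ι_snd, ← Category.assoc (toThick T m), toThick_snd, Category.assoc]
    congr 1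
    simp only [fatPointι, ← Spec.map_comp, ← CommRingCat.ofHom_comp, TruncPoly.map_res]

/-- The constant arc. -/
@[simps]
def AbsArc.const {S T : Scheme.{u}} (s : T ⟶ S) : AbsArc S T where
  jet m := thick.fst T m ≫ s
  ι_jet m := by simp

lemma AbsArc.pull_const {S T T' : Scheme.{u}} (s : T ⟶ S) (f : T' ⟶ T) :
    (const s).pull f = const (f ≫ s) := by
  ext m
  simp

/-- Arcs over `k` as absolute arcs. -/
def Arc.toAbs (a : Arc X T) : AbsArc X.left T.left where
  jet m := inv (jetDomain.toThick T m) ≫ a.jet m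
  ι_jet m := by
    rw [← cancel_epi (jetDomain.toThick T m), IsIso.hom_inv_id_assoc, ← a.ι_jet m,
      ← Category.assoc, ← jetDomain.ι_toThick, Category.assoc, IsIso.hom_inv_id_assoc]

lemma Arc.toThick_toAbs (a : Arc X T) (m : ℕ) :
    jetDomain.toThick T m ≫ a.toAbs.jet m = a.jet m := IsIso.hom_inv_id_assoc _ _

lemma Arc.toAbs_push (a : Arc X T) : a.toAbs.push X.hom = AbsArc.const T.hom := by
  ext1
  ext1 m
  rw [← cancel_epi (jetDomain.toThick T m), AbsArc.push_jet, AbsArc.const_jet, ← Category.assoc,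
    a.toThick_toAbs, ← Category.assoc, jetDomain.toThick_fst, a.jet_over]

lemma Arc.toAbs_pull (f : T' ⟶ T) (a : Arc X T) : (a.pull f).toAbs = a.toAbs.pull f.left := by
  ext1
  ext1 m
  rw [← cancel_epi (jetDomain.toThick T' m), toThick_toAbs, AbsArc.pull_jet, pull_jet,
    ← Category.assoc, ← jetDomain.map_toThick, Category.assoc, toThick_toAbs]

lemma Arc.toAbs_injective {a b : Arc X T} (h : a.toAbs = b.toAbs) : a = b := by
  ext1
  ext1 m
  rw [← a.toThick_toAbs, h, b.toThick_toAbs]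

lemma Arc.exists_toAbs (b : AbsArc X.left T.left) (hb : b.push X.hom = AbsArc.const T.hom) :
    ∃ a : Arc X T, a.toAbs = b := by
  have hb' (m : ℕ) : b.jet m ≫ X.hom = thick.fst T.left m ≫ T.hom := congr(($hb).jet m)
  refine ⟨⟨fun m ↦ jetDomain.toThick T m ≫ b.jet m, fun m ↦ ?_, fun m ↦ ?_⟩, ?_⟩
  · rw [Category.assoc, hb', ← Category.assoc, jetDomain.toThick_fst]
  · rw [← Category.assoc, jetDomain.ι_toThick, Category.assoc, b.ι_jet]
  · ext1
    ext1 m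
    exact IsIso.inv_hom_id_assoc _ _

end Comparison

lemma exists_absArc_equiv (X : Scheme.{u}) : ∃ (Z : Scheme.{u}) (e : ∀ T, (T ⟶ Z) ≃ AbsArc X T),
    ∀ (T T' : Scheme.{u}) (f : T' ⟶ T) (g : T ⟶ Z), e T' (f ≫ g) = (e T g).pull f :=
  ⟨_, fun _ ↦ (absArc X).representableBy.homEquiv,
    fun _ _ f g ↦ (absArc X).representableBy.homEquiv_comp f g⟩

/-- The arc space of every `k`-scheme exists. -/
instance arcFunctor_isRepresentable (X : Over (Spec (.of k))) :
    (arcFunctor X).IsRepresentable := by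
  obtain ⟨A, e, he⟩ := exists_absArc_equiv X.left
  obtain ⟨B, e', he'⟩ := exists_absArc_equiv (Spec (.of k))
  let p : A ⟶ B := (e' A).symm ((e A (𝟙 _)).push X.hom)
  let c : Spec (.of k) ⟶ B := (e' _).symm (AbsArc.const (𝟙 _))
  have hp {T : Scheme.{u}} (h : T ⟶ A) : e' T (h ≫ p) = (e T h).push X.hom := by
    rw [he', Equiv.apply_symm_apply, ← AbsArc.pull_push, ← he, Category.comp_id]
  have hc {T : Scheme.{u}} (s : T ⟶ Spec (.of k)) : e' T (s ≫ c) = AbsArc.const s := by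
    rw [he', Equiv.apply_symm_apply, AbsArc.pull_const, Category.comp_id]
  let P : Over (Spec (.of k)) := Over.mk (pullback.snd p c)
  have hP {T : Over (Spec (.of k))} (h : T ⟶ P) :
      (e _ (h.left ≫ pullback.fst p c)).push X.hom = AbsArc.const T.hom := by
    have hw : h.left ≫ pullback.snd p c = T.hom := Over.w h
    rw [← hp, Category.assoc, pullback.condition, ← Category.assoc, hw, hc]
  choose F hF using fun {T : Over (Spec (.of k))} (h : T ⟶ P) ↦ Arc.exists_toAbs _ (hP h)
  have hbij (T : Over (Spec (.of k))) : Function.Bijective (F : (T ⟶ P) → Arc X T) := by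
    refine ⟨fun h h' eq ↦ ?_, fun a ↦ ?_⟩
    · have eq' : e _ (h.left ≫ pullback.fst p c) = e _ (h'.left ≫ pullback.fst p c) := by
        rw [← hF, ← hF, eq]
      refine Over.OverMorphism.ext (pullback.hom_ext ((e _).injective eq') ?_)
      exact (Over.w h).trans (Over.w h').symm
    · have hq : (e _).symm a.toAbs ≫ p = T.hom ≫ c := by
        apply (e' _).injective
        rw [hp, hc, ← a.toAbs_push, Equiv.apply_symm_apply]
      refine ⟨Over.homMk (pullback.lift _ T.hom hq) (pullback.lift_snd _ _ _), ?_⟩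
      apply Arc.toAbs_injective
      refine (hF _).trans ?_
      refine (congrArg (e T.left) (pullback.lift_fst _ _ hq)).trans ?_
      exact Equiv.apply_symm_apply _ _
  exact ⟨P, ⟨⟨fun {T} ↦ Equiv.ofBijective F (hbij T), fun {T T'} f g ↦ by
    apply Arc.toAbs_injective
    refine (hF _).trans (Eq.trans ?_ (Arc.toAbs_pull f (F g)).symm)
    rw [hF, Over.comp_left, Category.assoc, he]⟩⟩⟩

end Representability

/-! ### The arc space -/

section ArcSpace

variable {k : Type u} [CommRing k] {X Y : Over (Spec (.of k))}

/-- The arc space `X_∞` of a scheme `X` over `k`: the scheme over `k` representing the functor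
of arcs on `X`. -/
def arcSpace (X : Over (Spec (.of k))) : Over (Spec (.of k)) := (arcFunctor X).reprX

/-- The functor of points of the arc space. -/
def arcSpaceRepresentableBy (X : Over (Spec (.of k))) :
    (arcFunctor X).RepresentableBy (arcSpace X) := (arcFunctor X).representableBy

/-- The morphism `f_∞ : X_∞ ⟶ Y_∞` induced by `f : X ⟶ Y`, given on points by composition of
arcs with `f`. -/
def arcSpaceMap (f : X ⟶ Y) : arcSpace X ⟶ arcSpace Y :=
  (arcSpaceRepresentableBy Y).homEquiv.symm
    (Arc.push ((arcSpaceRepresentableBy X).homEquiv (𝟙 (arcSpace X))) f)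

end ArcSpace

/-- A variety over `k`: an integral separated scheme of finite type over `k`. -/
class IsVariety {k : Type u} [Field k] (X : Over (Spec (.of k))) : Prop where
  isIntegral : IsIntegral X.left
  isSeparated : IsSeparated X.hom
  locallyOfFiniteType : LocallyOfFiniteType X.hom
  quasiCompact : QuasiCompact X.hom

attribute [instance] IsVariety.isIntegral

/-- A scheme is normal if all its local rings are integrally closed domains. -/
class IsNormalScheme (X : Scheme.{u}) : Prop where
  isDomain_stalk : ∀ x : X, IsDomain (X.presheaf.stalk x)
  isIntegrallyClosed_stalk : ∀ x : X, IsIntegrallyClosed (X.presheaf.stalk x)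

/-- A scheme is topologically finite if its underlying space is finite and discrete. -/
structure IsTopologicallyFinite (X : Scheme.{u}) : Prop where
  finite : Finite X
  discrete : DiscreteTopology X

section SepDegree

variable {X Y : Scheme.{u}} [IsIntegral X] [IsIntegral Y] (f : X ⟶ Y) [IsDominant f]

lemma map_genericPoint_specializes : f (genericPoint X) ⤳ genericPoint Y := by
  rw [specializes_iff_mem_closure]
  have h : closure {f (genericPoint X)} = Set.univ := by
    have := (genericPoint_spec X).image f.continuous
    rw [Set.image_univ, f.denseRange.closure_range] at this
    exact this
  rw [h]
  trivial

/-- The extension of function fields `k(Y) → k(X)` induced by a dominant morphism `X ⟶ Y`. -/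
def functionFieldMap : Y.functionField →+* X.functionField :=
  (Y.presheaf.stalkSpecializes (map_genericPoint_specializes f) ≫
    f.stalkMap (genericPoint X)).hom

/-- The separable degree `[k(X) : k(Y)]_sep` of a dominant morphism `X ⟶ Y` whose extension of
function fields is finite: the degree over `k(Y)` of the separable closure of `k(Y)` in `k(X)`. -/
def sepDegree : ℕ :=
  letI : Algebra Y.functionField X.functionField := (functionFieldMap f).toAlgebra
  Module.finrank Y.functionField (separableClosure Y.functionField X.functionField)

end SepDegree

end ArcSpaces

end

open CategoryTheory AlgebraicGeometry ArcSpaces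

noncomputable section

open CategoryTheory Limits Opposite AlgebraicGeometry Polynomial

namespace ArcSpaces

/-! ### Homomorphisms out of integral extensions of normal domains -/

/-! The bound is first proved for points with values in a field, and then turned into a statement
about the topology of the fiber.

An arc with values in a field `L` starts at one point, so it factors through any affine open
neighborhood of that point. Let `B` be the coordinate ring of a small affine open of `Y`, and `A`
that of its preimage, which is finite over `B`. An arc on `Y` becomes a homomorphism `B → L[[t]]`,
and its lifts to `X` become its extensions to `A`. This homomorphism need not be injective (the arc
may lie in the branch locus), so field theory does not apply to it directly. Since the ground field
is infinite, however, one element `a` of `A` separates any finite set of extensions. By normality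
the minimal polynomial of `a` over `B` is also its minimal polynomial over `K = Frac B`. The images
of `a` are roots of its specialization in the domain `L[[t]]`. After removal of the inseparable part
by a power of Frobenius, there are at most `[K(a) : K]_s` of them, which is at most `[Frac A :
K]_s`. This is `card_le_finSepDegree`, globalized in `card_le_sepDegree_of_push`.

Hence the fiber has at most `d = sepdeg f` points in every extension field of the residue field `κ`
of `β`, over a fixed `Spec L → Spec κ`. Such a scheme has residue fields algebraic over `κ`, since a
transcendental extension has infinitely many embeddings into a suitable field. So each of its points
lifts to a point with values in the algebraic closure of `κ`, which bounds their number by `d`. The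
same algebraicity, applied to the primes of a stalk, excludes specializations. A finite T1 space is
discrete, which gives `HasFewPoints.isTopologicallyFinite`. -/

/-- A polynomial over a domain that becomes irreducible over a field has, after any
specialization of its coefficients, no more roots than its separable degree. -/
theorem card_le_natSepDegree_of_isRoot {B K Ω ι : Type*} [CommRing B] [Field K] [CommRing Ω]
    [IsDomain Ω] [Algebra B K] [FaithfulSMul B K] [Algebra B Ω] (q : ℕ) [ExpChar K q]
    [ExpChar Ω q] {p : B[X]} (hp : p.Monic) (hirr : Irreducible (p.map (algebraMap B K)))
    {x : ι → Ω} (hx : Function.Injective x) (hroot : ∀ i, aeval (x i) p = 0) :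
    Nat.card ι ≤ (p.map (algebraMap B K)).natSepDegree := by
  classical
  have hinj : Function.Injective (algebraMap B K) := FaithfulSMul.algebraMap_injective B K
  obtain ⟨g, hg⟩ := hirr.hasSeparableContraction q
  have hg' := hg
  obtain ⟨hgs, m, hm⟩ := hg'
  have hq : q ^ m ≠ 0 := (expChar_pow_pos K q m).ne'
  -- The separable contraction `g` lives over `K`. Contracting `p` itself gives a model of it over
  -- `B`, which can be specialized to `Ω`. Its specialization may lose separability, but only its
  -- degree is needed.
  set h := contract (q ^ m) p
  have hh : h.map (algebraMap B K) = g := by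
    rw [map_contract hq, ← hm, contract_expand (hp := hq)]
  have hhp : expand B (q ^ m) h = p := by
    apply Polynomial.map_injective _ hinj
    rw [map_expand, hh, hm]
  have hmon : h.Monic := by
    rw [← monic_expand_iff (expChar_pow_pos K q m), hhp]
    exact hp
  let y : ι → (h.map (algebraMap B Ω)).roots.toFinset := fun i ↦ ⟨x i ^ q ^ m, by
    rw [Multiset.mem_toFinset, mem_roots (hmon.map _).ne_zero, IsRoot, eval_map_algebraMap,
      ← expand_aeval, hhp, hroot]⟩
  -- Frobenius is injective on the domain `Ω`, so distinct roots of `p` give distinct roots of `h`.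
  have hy : Function.Injective y := fun i j hij ↦ hx <| by
    have := congrArg Subtype.val hij
    exact iterateFrobenius_inj Ω q m this
  calc Nat.card ι ≤ Nat.card (h.map (algebraMap B Ω)).roots.toFinset :=
        Nat.card_le_card_of_injective y hy
    _ ≤ Multiset.card (h.map (algebraMap B Ω)).roots := by
        rw [Nat.card_eq_fintype_card, Fintype.card_coe]
        exact Multiset.toFinset_card_le _
    _ ≤ (h.map (algebraMap B Ω)).natDegree := card_roots' _
    _ = g.natDegree := by rw [hmon.natDegree_map, ← hh, hmon.natDegree_map]
    _ = _ := hg.natSepDegree_eq.symm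

/-- Finitely many algebra homomorphisms over an infinite field are separated by one element. -/
theorem exists_injective_eval {k A Ω ι : Type*} [Field k] [Infinite k] [CommRing A] [Algebra k A]
    [CommRing Ω] [Algebra k Ω] [Finite ι] {ψ : ι → A →ₐ[k] Ω} (hψ : Function.Injective ψ) :
    ∃ a, Function.Injective fun i ↦ ψ i a := by
  by_contra! H
  -- If no element separates the maps, the equalizers of pairs cover `A`. A vector space over an
  -- infinite field is not a finite union of proper subspaces, so one equalizer is everything.
  let s (e : {e : ι × ι // e.1 ≠ e.2}) : Submodule k A :=
    LinearMap.ker ((ψ e.1.1).toLinearMap - (ψ e.1.2).toLinearMap)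
  obtain ⟨⟨⟨i, j⟩, hij⟩, h⟩ := Subspace.exists_eq_top_of_iUnion_eq_univ (p := s) (by
    refine Set.eq_univ_of_forall fun a ↦ ?_
    obtain ⟨i, j, h, hij⟩ : ∃ i j, ψ i a = ψ j a ∧ i ≠ j := by
      simpa [Function.Injective] using H a
    exact Set.mem_iUnion.2 ⟨⟨(i, j), hij⟩, by simp [s, h]⟩)
  refine hij (hψ (AlgHom.ext fun a ↦ ?_))
  have : a ∈ s ⟨(i, j), hij⟩ := h ▸ Submodule.mem_top
  simpa [s, sub_eq_zero] using this

/-- A ring homomorphism from a normal domain `B` to a domain has at most `[L : K]_s` extensions to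
a domain integral over `B`, where `L / K` is the extension of fraction fields. -/
theorem card_le_finSepDegree (k : Type*) {B A K L Ω ι : Type*} [Field k] [Infinite k]
    [CommRing B] [IsDomain B] [IsIntegrallyClosed B] [CommRing A] [IsDomain A] [Algebra k B]
    [Algebra B A] [Algebra.IsIntegral B A] [FaithfulSMul B A] [Field K] [Algebra B K]
    [IsFractionRing B K] [Field L] [Algebra A L] [IsFractionRing A L] [Algebra K L] [Algebra B L]
    [IsScalarTower B A L] [IsScalarTower B K L] [FiniteDimensional K L] [CommRing Ω] [IsDomain Ω]
    [Algebra B Ω] [Finite ι] {ψ : ι → A →ₐ[B] Ω} (hψ : Function.Injective ψ) :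
    Nat.card ι ≤ Field.finSepDegree K L := by
  let : Algebra k A := ((algebraMap B A).comp (algebraMap k B)).toAlgebra
  let : Algebra k Ω := ((algebraMap B Ω).comp (algebraMap k B)).toAlgebra
  have : IsScalarTower k B A := .of_algebraMap_eq fun _ ↦ rfl
  have : IsScalarTower k B Ω := .of_algebraMap_eq fun _ ↦ rfl
  obtain ⟨a, ha⟩ := exists_injective_eval (k := k) (ψ := fun i ↦ (ψ i).restrictScalars k)
    ((AlgHom.restrictScalars_injective k).comp hψ)
  have hint : IsIntegral B a := Algebra.IsIntegral.isIntegral a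
  -- Normality of `B` enters here: the minimal polynomial over `B` stays irreducible over `K`.
  have hmin := minpoly.isIntegrallyClosed_eq_field_fractions K L hint
  have halg : IsIntegral K (algebraMap A L a) := Algebra.IsIntegral.isIntegral _
  obtain ⟨q, _⟩ := ExpChar.exists k
  have : ExpChar K q := expChar_of_injective_ringHom
    ((algebraMap B K).comp (algebraMap k B)).injective q
  have : ExpChar Ω q := expChar_of_injective_algebraMap (algebraMap k Ω).injective q
  have h := (card_le_natSepDegree_of_isRoot (K := K) q (minpoly.monic hint)
    (hmin ▸ minpoly.irreducible halg) ha fun i ↦ by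
      change aeval (ψ i a) _ = 0
      rw [aeval_algHom_apply, minpoly.aeval, map_zero])
  rw [← hmin, ← IntermediateField.finSepDegree_adjoin_simple_eq_natSepDegree _ _
    halg.isAlgebraic] at h
  -- Separable degrees are multiplicative in the tower `K ⊆ K(a) ⊆ L`.
  refine h.trans (Nat.le_of_dvd (Nat.pos_of_ne_zero (NeZero.ne _)) ?_)
  rw [← Field.finSepDegree_mul_finSepDegree_of_isAlgebraic K
    (IntermediateField.adjoin K {algebraMap A L a}) L]
  exact dvd_mul_right _ _

/-- A transcendental extension has infinitely many embeddings into an algebraic closure of `E`; this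
is the field `L` to test. -/
theorem isAlgebraic_of_finite_algHom {F E : Type u} [Field F] [Field E] [Algebra F E]
    (h : ∀ (L : Type u) [Field L] [Algebra F L], Finite (E →ₐ[F] L)) :
    Algebra.IsAlgebraic F E := by
  by_contra H
  rw [← Algebra.transcendental_iff_not_isAlgebraic] at H
  exact (Field.infinite_emb_of_transcendental F E).not_finite (h _)

/-! ### Schemes over a field with finitely many points in every field -/

section FewPoints

variable {κ : Type u} [Field κ] {Z : Scheme.{u}} {p : Z ⟶ Spec (.of κ)} {d : ℕ}

/-- The scheme `Z` over `κ` has at most `d` points with values in any field over `κ`. -/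
def HasFewPoints (p : Z ⟶ Spec (.of κ)) (d : ℕ) : Prop :=
  ∀ (L : Type u) [Field L] (s : Spec (.of L) ⟶ Spec (.of κ)) (n : ℕ)
    (g : Fin n → (Spec (.of L) ⟶ Z)), Function.Injective g → (∀ i, g i ≫ p = s) → n ≤ d

/-- Composition with the monomorphism `m` turns distinct `κ`-embeddings of `E` into `L` into
distinct `L`-points of `Z` over the same point of `Spec κ`, so there are at most `d` of them. -/
lemma HasFewPoints.isAlgebraic (h : HasFewPoints p d) {E : Type u} [Field E] [Algebra κ E]
    (m : Spec (.of E) ⟶ Z) [Mono m]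
    (hm : m ≫ p = Spec.map (CommRingCat.ofHom (algebraMap κ E))) : Algebra.IsAlgebraic κ E := by
  refine isAlgebraic_of_finite_algHom fun L _ _ ↦ ?_
  by_contra H
  rw [not_finite_iff_infinite] at H
  let e : Fin (d + 1) ↪ (E →ₐ[κ] L) := Fin.valEmbedding.trans (Infinite.natEmbedding _)
  refine absurd (h L (Spec.map (CommRingCat.ofHom (algebraMap κ L))) (d + 1)
    (fun i ↦ Spec.map (CommRingCat.ofHom (e i).toRingHom) ≫ m) (fun i j hij ↦ ?_) fun i ↦ ?_)
    (by omega)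
  · have h1 := Spec.map_injective ((cancel_mono m).1 hij)
    exact e.injective (AlgHom.coe_ringHom_injective congr(($h1).hom))
  · rw [Category.assoc, hm, ← Spec.map_comp, ← CommRingCat.ofHom_comp]
    congr 2
    exact (e i).comp_algebraMap

lemma HasFewPoints.exists_geometric_point (h : HasFewPoints p d) {E : Type u} [Field E]
    (m : Spec (.of E) ⟶ Z) [Mono m] :
    ∃ e : Spec (.of (AlgebraicClosure κ)) ⟶ Spec (.of E),
      (e ≫ m) ≫ p = Spec.map (CommRingCat.ofHom (algebraMap κ (AlgebraicClosure κ))) := by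
  obtain ⟨φ, hφ⟩ := Spec.map_surjective (m ≫ p)
  let _ : Algebra κ E := φ.hom.toAlgebra
  have := h.isAlgebraic m hφ.symm
  let e : E →ₐ[κ] AlgebraicClosure κ := IsAlgClosed.lift
  refine ⟨Spec.map (CommRingCat.ofHom e.toRingHom), ?_⟩
  rw [Category.assoc, ← hφ, ← Spec.map_comp]
  congr 1
  exact CommRingCat.hom_ext e.comp_algebraMap

lemma exists_mono_of_point (z : Z) : ∃ (E : Type u) (_ : Field E) (m : Spec (.of E) ⟶ Z),
    Mono m ∧ ∀ t, m t = z :=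
  ⟨IsLocalRing.ResidueField (Z.presheaf.stalk z), inferInstance, Z.fromSpecResidueField z,
    inferInstanceAs (Mono (Z.fromSpecResidueField z)), Z.fromSpecResidueField_apply z⟩

lemma HasFewPoints.card_le (h : HasFewPoints p d) {n : ℕ} {z : Fin n → Z}
    (hz : Function.Injective z) : n ≤ d := by
  -- Every point is the image of a geometric point with the same source and the same map to `Spec
  -- κ`, so the bound applies to all of them at once.
  have key (x : Z) : ∃ g : Spec (.of (AlgebraicClosure κ)) ⟶ Z, (∀ t, g t = x) ∧
      g ≫ p = Spec.map (CommRingCat.ofHom (algebraMap κ (AlgebraicClosure κ))) := by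
    obtain ⟨E, _, m, _, hm⟩ := exists_mono_of_point x
    obtain ⟨e, he⟩ := h.exists_geometric_point m
    exact ⟨e ≫ m, fun t ↦ by rw [Scheme.Hom.comp_apply, hm], he⟩
  choose g hg hgp using key
  refine h _ _ n (fun i ↦ g (z i)) (fun i j hij ↦ hz ?_) fun i ↦ hgp _
  let t : Spec (.of (AlgebraicClosure κ)) := IsLocalRing.closedPoint (AlgebraicClosure κ)
  rw [← hg (z i) t, ← hg (z j) t, show g (z i) = g (z j) from hij]

lemma mono_specMap_algebraMap_residueField {R : CommRingCat.{u}} (P : PrimeSpectrum R) :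
    Mono (Spec.map (CommRingCat.ofHom (algebraMap R P.asIdeal.ResidueField))) := by
  have h := Scheme.Spec.map_residueFieldIso_inv_eq_fromSpecResidueField R P
  rw [← (IsIso.eq_inv_comp _)] at h
  have hm (x : Spec R) : Mono ((Spec R).fromSpecResidueField x) := inferInstance
  have := hm P
  rw [h]
  exact mono_comp _ _

/-- The residue field of `P` is algebraic over `κ`, hence so is its subring `R ⧸ P`. A domain
integral over a field is a field, so `P` is maximal. For stalks of `Z` this says that no point has a
proper generization. -/
lemma HasFewPoints.eq_closedPoint (h : HasFewPoints p d) {R : CommRingCat.{u}} [IsLocalRing R]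
    (m : Spec R ⟶ Z) [Mono m] (P : PrimeSpectrum R) : P = IsLocalRing.closedPoint R := by
  let E := P.asIdeal.ResidueField
  have hmono : Mono (Spec.map (CommRingCat.ofHom (algebraMap R E))) :=
    mono_specMap_algebraMap_residueField P
  obtain ⟨φ, hφ⟩ := Spec.map_surjective (m ≫ p)
  let _ : Algebra κ R := φ.hom.toAlgebra
  have : Algebra.IsAlgebraic κ E :=
    h.isAlgebraic (Spec.map (CommRingCat.ofHom (algebraMap R E)) ≫ m) (by
      rw [Category.assoc, ← hφ, ← Spec.map_comp]
      rfl)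
  have : Algebra.IsAlgebraic κ (R ⧸ P.asIdeal) :=
    .of_injective (IsScalarTower.toAlgHom κ (R ⧸ P.asIdeal) E)
      (IsFractionRing.injective (R ⧸ P.asIdeal) E)
  have : P.asIdeal.IsMaximal := Ideal.Quotient.maximal_of_isField _
    (isField_of_isIntegral_of_isField' (R := κ) (Field.toIsField κ))
  exact PrimeSpectrum.ext (IsLocalRing.eq_maximalIdeal this)

lemma HasFewPoints.eq_of_specializes (h : HasFewPoints p d) {x y : Z} (hxy : x ⤳ y) : x = y := by
  obtain ⟨P, rfl⟩ : x ∈ Set.range (Z.fromSpecStalk y) := by rwa [Scheme.range_fromSpecStalk]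
  rw [h.eq_closedPoint (Z.fromSpecStalk y) P]
  exact Scheme.fromSpecStalk_closedPoint

theorem HasFewPoints.isTopologicallyFinite (h : HasFewPoints p d) :
    IsTopologicallyFinite Z ∧ Nat.card Z ≤ d := by
  have hfin : Finite Z := by
    by_contra H
    rw [not_finite_iff_infinite] at H
    have := h.card_le (n := d + 1) (z := Fin.valEmbedding.trans (Infinite.natEmbedding Z))
      (Function.Embedding.injective _)
    omega
  have : T1Space Z := t1Space_iff_specializes_imp_eq.2 fun _ _ ↦ h.eq_of_specializes
  exact ⟨⟨hfin, inferInstance⟩, h.card_le (Finite.equivFin Z).symm.injective⟩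

end FewPoints

/-! ### Arcs over a finite morphism with normal target -/

/-- An arc on an affine scheme is given by a homomorphism to a ring of power series. -/
lemma AbsArc.exists_ringHom {A R : Type u} [CommRing A] [CommRing R]
    (g : AbsArc (Spec (.of A)) (Spec (.of R))) :
    ∃ G : A →+* PowerSeries R, ∀ m, thickSpec R m ≫ g.jet m =
      Spec.map (CommRingCat.ofHom ((TruncPoly.ofPowerSeries R m).comp G)) := by
  obtain ⟨h, rfl⟩ := univArc_surj_affine g
  obtain ⟨φ, rfl⟩ := Spec.map_surjective h
  exact ⟨(PowerSeries.map φ.hom).comp (hsUniv A), thickSpec_univArc φ.hom⟩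

/-- Integral closedness can be checked at the maximal ideals, where the localizations are stalks of
`Y`. -/
lemma isIntegrallyClosed_of_isAffineOpen {Y : Scheme.{u}} [IsIntegral Y] [IsNormalScheme Y]
    {V : Y.Opens} (hV : IsAffineOpen V) [Nonempty V] : IsIntegrallyClosed Γ(Y, V) := by
  refine IsIntegrallyClosed.of_localization_maximal fun P _ hP ↦ ?_
  let x : PrimeSpectrum Γ(Y, V) := ⟨P, hP.isPrime⟩
  let _ : Algebra Γ(Y, V) (Y.presheaf.stalk (hV.fromSpec x)) :=
    TopCat.Presheaf.algebra_section_stalk Y.presheaf ⟨hV.fromSpec x, (hV.isoSpec.inv x).2⟩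
  have : IsLocalization.AtPrime (Y.presheaf.stalk (hV.fromSpec x)) P :=
    hV.isLocalization_stalk' x (hV.isoSpec.inv x).2
  have := IsNormalScheme.isIntegrallyClosed_stalk (hV.fromSpec x)
  exact IsIntegrallyClosed.of_equiv
    (IsLocalization.algEquiv P.primeCompl (Y.presheaf.stalk (hV.fromSpec x))
      (Localization.AtPrime P)).toRingEquiv

/-- Identifies the extension of function fields with the extension of fraction fields of the
coordinate rings of an affine open and its preimage. -/
lemma functionFieldMap_germ {X Y : Scheme.{u}} [IsIntegral X] [IsIntegral Y] (f : X ⟶ Y)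
    [IsDominant f] (V : Y.Opens) [Nonempty V] [Nonempty (f ⁻¹ᵁ V)] :
    (functionFieldMap f).comp (Y.germToFunctionField V).hom =
      (X.germToFunctionField (f ⁻¹ᵁ V)).hom.comp (f.app V).hom := by
  have h : f (genericPoint X) ∈ V :=
    (map_genericPoint_specializes f).mem_open V.2
      (((genericPoint_spec Y).mem_open_set_iff V.isOpen).mpr (by simpa using ‹Nonempty V›))
  rw [functionFieldMap, ← CommRingCat.hom_comp, ← CommRingCat.hom_comp,
    TopCat.Presheaf.germ_stalkSpecializes_assoc, Scheme.Hom.germ_stalkMap]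

/-- `card_le_finSepDegree` in terms of ring homomorphisms. -/
lemma card_le_finrank_separableClosure {k B A K F Ω : Type u} [Field k] [Infinite k] [CommRing B]
    [IsDomain B] [IsIntegrallyClosed B] [CommRing A] [IsDomain A] [Field K] [Algebra B K]
    [IsFractionRing B K] [Field F] [Algebra A F] [IsFractionRing A F] [CommRing Ω] [IsDomain Ω]
    (c : k →+* B) {φ : B →+* A} (hφ : φ.Finite) {θ : K →+* F}
    (h : θ.comp (algebraMap B K) = (algebraMap A F).comp φ) {n : ℕ} {G : Fin n → A →+* Ω}
    (hG : Function.Injective G) {g : B →+* Ω} (hg : ∀ i, (G i).comp φ = g) :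
    n ≤ (letI : Algebra K F := θ.toAlgebra
      Module.finrank K (separableClosure K F)) := by
  let _ : Algebra k B := c.toAlgebra
  let _ : Algebra B A := φ.toAlgebra
  let _ : Algebra B Ω := g.toAlgebra
  let _ : Algebra K F := θ.toAlgebra
  let _ : Algebra B F := ((algebraMap A F).comp φ).toAlgebra
  have : IsScalarTower B A F := .of_algebraMap_eq fun _ ↦ rfl
  have : IsScalarTower B K F := .of_algebraMap_eq' h.symm
  have : Module.Finite B A := hφ
  -- Injectivity of `φ` comes from the fraction fields: `B → K → F` is injective and factors through
  -- `φ`.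
  have hinj : Function.Injective (algebraMap B A) := by
    have h1 : Function.Injective ((algebraMap A F).comp φ) := by
      rw [← h]
      exact θ.injective.comp (IsFractionRing.injective B K)
    exact Function.Injective.of_comp h1
  have : FaithfulSMul B A := (faithfulSMul_iff_algebraMap_injective B A).2 hinj
  have : FiniteDimensional K F := .of_isLocalization B A (nonZeroDivisors B)
  have key := card_le_finSepDegree k (B := B) (A := A) (K := K) (L := F) (Ω := Ω)
    (ψ := fun i : Fin n ↦ { G i with commutes' := RingHom.congr_fun (hg i) })
    (fun i j hij ↦ hG (RingHom.ext fun x ↦ DFunLike.congr_fun hij x))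
  rwa [Field.finSepDegree_eq, Nat.card_fin] at key

/-- Extensions of an arc to a finite cover of a normal scheme over an infinite field. -/
theorem card_le_sepDegree_of_push {k : Type u} [Field k] [Infinite k] {X Y : Scheme.{u}}
    [IsIntegral X] [IsIntegral Y] [IsNormalScheme Y] (π : Y ⟶ Spec (.of k)) (f : X ⟶ Y)
    [IsFinite f] [IsDominant f] {L : Type u} [Field L] {n : ℕ}
    {a : Fin n → AbsArc X (Spec (.of L))} (ha : Function.Injective a)
    {b : AbsArc Y (Spec (.of L))} (hab : ∀ i, (a i).push f = b) : n ≤ sepDegree f := by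
  let o : Spec (.of L) := IsLocalRing.closedPoint L
  obtain ⟨V, hV, hbV, -⟩ := exists_isAffineOpen_mem_and_subset (U := (⊤ : Y.Opens))
    (x := b.base o) trivial
  have : Nonempty V := ⟨⟨_, hbV⟩⟩
  have : Nonempty (f ⁻¹ᵁ V) := by
    obtain ⟨x, hx⟩ := f.denseRange.exists_mem_open V.2 ⟨_, hbV⟩
    exact ⟨⟨x, hx⟩⟩
  have hU : IsAffineOpen (f ⁻¹ᵁ V) := hV.preimage f
  have hbase (x : Spec (.of L)) : b.base x ∈ V := by
    rwa [Subsingleton.elim (α := PrimeSpectrum L) x o]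
  have hlift (i) : ∃ G : Γ(X, f ⁻¹ᵁ V) →+* PowerSeries L, ∀ m, thickSpec L m ≫ (a i).jet m =
      Spec.map (CommRingCat.ofHom ((TruncPoly.ofPowerSeries L m).comp G)) ≫ hU.fromSpec := by
    -- An arc factors through an open subscheme as soon as its starting point lies there. The arc `a
    -- i` starts in the preimage of `V` because its image `b` starts in `V`.
    obtain ⟨a', ha'⟩ := AbsArc.exists_push hU.fromSpec (a i) (by
      rw [hU.range_fromSpec]
      rintro _ ⟨x, rfl⟩
      change f ((a i).base x) ∈ V
      rw [← Scheme.Hom.comp_apply, ← AbsArc.base_push, hab]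
      exact hbase x)
    obtain ⟨G, hG⟩ := AbsArc.exists_ringHom (A := Γ(X, f ⁻¹ᵁ V)) a'
    refine ⟨G, fun m ↦ ?_⟩
    rw [← hG, ← ha']
    exact (Category.assoc _ _ _).symm
  choose G hG using hlift
  have hGinj : Function.Injective G := fun i j hij ↦ ha (AbsArc.ext (funext fun m ↦ by
    rw [← cancel_epi (thickSpec L m), hG, hG, hij]))
  -- All the `G i` restrict to the same homomorphism on `Γ(Y, V)`, the one that describes `b`.
  have hpush (i j) : (G i).comp (f.app V).hom = (G j).comp (f.app V).hom := by
    refine RingHom.ext fun s ↦ TruncPoly.ofPowerSeries_jointly_injective fun m ↦ ?_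
    have hb (i) : thickSpec L m ≫ b.jet m = Spec.map (CommRingCat.ofHom
        ((TruncPoly.ofPowerSeries L m).comp ((G i).comp (f.app V).hom))) ≫ hV.fromSpec := by
      have h1 := hV.SpecMap_appLE_fromSpec f hU le_rfl
      rw [Scheme.Hom.appLE_eq_app] at h1
      rw [← hab i, AbsArc.push_jet, ← Category.assoc, hG, Category.assoc, ← h1, ← Category.assoc,
        ← Spec.map_comp]
      rfl
    have h2 := Spec.map_injective ((cancel_mono hV.fromSpec).1 ((hb i).symm.trans (hb j)))
    exact congr(($h2).hom s)
  -- For positive `n`, index `0` supplies this common restriction.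
  rcases n with _ | n
  · exact Nat.zero_le _
  have := isIntegrallyClosed_of_isAffineOpen hV
  have := functionField_isFractionRing_of_isAffineOpen Y V hV
  have := functionField_isFractionRing_of_isAffineOpen X _ hU
  let c : k →+* Γ(Y, V) := (Y.presheaf.map (homOfLE le_top).op).hom.comp
    (π.appTop.hom.comp (Scheme.ΓSpecIso (.of k)).inv.hom)
  exact card_le_finrank_separableClosure c (IsFinite.finite_app f V hV) (functionFieldMap_germ f V) hGinj
    (fun i ↦ hpush i 0)

/-! ### From points of the arc space to arcs, and the fibers of `f_∞` -/

lemma Arc.push_toAbs {k : Type u} [CommRing k] {X Y T : Over (Spec (.of k))} (a : Arc X T)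
    (f : X ⟶ Y) : (a.push f).toAbs = a.toAbs.push f.left := by
  refine AbsArc.ext (funext fun m ↦ ?_)
  rw [← cancel_epi (jetDomain.toThick T m), toThick_toAbs, AbsArc.push_jet, push_jet,
    ← Category.assoc, toThick_toAbs]

/-- Yoneda: `arcSpaceMap` is defined by its effect on the universal arc, and naturality in `T`
carries this to every `T`-valued arc. -/
lemma homEquiv_comp_arcSpaceMap {k : Type u} [CommRing k] {X Y T : Over (Spec (.of k))}
    (f : X ⟶ Y) (g : T ⟶ arcSpace X) :
    (arcSpaceRepresentableBy Y).homEquiv (g ≫ arcSpaceMap f) =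
      Arc.push ((arcSpaceRepresentableBy X).homEquiv g) f := by
  have hX := (arcSpaceRepresentableBy X).homEquiv_comp g (𝟙 _)
  have hY := (arcSpaceRepresentableBy Y).homEquiv_comp g (arcSpaceMap f)
  rw [Category.comp_id] at hX
  refine hY.trans (Eq.trans ?_ congr(Arc.push $hX f).symm)
  refine congr((arcFunctor Y).map g.op $(Equiv.apply_symm_apply _ _)).trans ?_
  exact Arc.ext (funext fun m ↦ (Category.assoc _ _ _).symm)

end ArcSpaces

end

theorem theoremt {k : Type u} [Field k] [IsAlgClosed k] (X Y : Over (Spec (.of k)))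
    [IsVariety X] [IsVariety Y] (f : X ⟶ Y) [IsFinite f.left] [Surjective f.left]
    [IsNormalScheme Y.left] (β : (arcSpace Y).left) :
    IsTopologicallyFinite ((arcSpaceMap f).left.fiber β) ∧
      Nat.card ((arcSpaceMap f).left.fiber β) ≤ sepDegree f.left := by
  have : Infinite k := IsAlgClosed.instInfinite
  refine HasFewPoints.isTopologicallyFinite (κ := (arcSpace Y).left.residueField β)
    (p := (arcSpaceMap f).left.fiberToSpecResidueField β) fun L _ s n g hg hgs ↦ ?_
  let b : Spec (.of L) ⟶ (arcSpace Y).left := s ≫ (arcSpace Y).left.fromSpecResidueField β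
  have hgb (i) : (g i ≫ (arcSpaceMap f).left.fiberι β) ≫ (arcSpaceMap f).left = b := by
    rw [Category.assoc, Scheme.Hom.fiber_fac, ← Category.assoc, hgs]
  -- The `k`-structure on `Spec L` is the one induced by `b`, so that all the lifts `h i` are
  -- morphisms over `k`.
  let T : Over (Spec (.of k)) := Over.mk (b ≫ (arcSpace Y).hom)
  let h (i : Fin n) : T ⟶ arcSpace X := Over.homMk (g i ≫ (arcSpaceMap f).left.fiberι β) (by
    rw [← Over.w (arcSpaceMap f), ← Category.assoc, hgb]
    rfl)
  -- The fiber is a pullback, and the second projections of the `g i` all equal `s`.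
  have hinj : Function.Injective h := fun i j hij ↦ hg (Limits.pullback.hom_ext
    congr(($hij).left) ((hgs i).trans (hgs j).symm))
  have hb (i) : h i ≫ arcSpaceMap f = Over.homMk b := Over.OverMorphism.ext (hgb i)
  refine card_le_sepDegree_of_push Y.hom f.left (L := L)
    (a := fun i ↦ Arc.toAbs ((arcSpaceRepresentableBy X).homEquiv (h i)))
    (b := Arc.toAbs ((arcSpaceRepresentableBy Y).homEquiv (X := T) (Over.homMk b)))
    (fun i j hij ↦ hinj (Equiv.injective _ (Arc.toAbs_injective hij))) fun i ↦ ?_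
  rw [← hb i, homEquiv_comp_arcSpaceMap]
  exact (Arc.push_toAbs _ f).symm
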